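/- All rings are associative with identity and modules are left modules unless a side is indicated. Let $R$ and $S$ be rings and let ${}_RC_S$ be a semidualizing $(R,S)$-bimodule, that is: ${}_RC$ and $C_S$ both admit projective resolutions by finitely generated projective modules; the homothety maps $R\to\operatorname{Hom}_{S^{op}}(C,C)$ and $S\to\operatorname{Hom}_R(C,C)$ are isomorphisms; and $\operatorname{Ext}_R^{i}(C,C)=0=\operatorname{Ext}_{S^{op}}^{i}(C,C)$ for all $i\ge 1$. The Auslander class $\mathcal A_C(S)$ consists of all $S$-modules $N$ such that $\operatorname{Tor}^S_i(C,N)=0$ for all $i\ge 1$, $\operatorname{Ext}_R^i(C,C\otimes_SN)=0$ for all $i\ge 1$, and the map $\mu_N:N\to\operatorname{Hom}_R(C,C\otimes_SN)$, $\mu_N(x)(c)=c\otimes x$, is an isomorphism. The Auslander projective dimension of an $S$-module $N$ is the infimum of all $n\ge 0$ for which there is an exact sequence $0\to X_n\to\cdots\to X_1\to X_0\to N\to 0$ of $S$-modules with all $X_i\in\mathcal A_C(S)$; it is infinite if there is no such $n$. Then the class of $S$-modules of finite Auslander projective dimension is closed under extensions, kernels of epimorphisms and cokernels of monomorphisms.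 That is, for every exact sequence $0\to N_1\to N_2\to N_3\to 0$ of $S$-modules: (1) if $N_1$ and $N_3$ have finite Auslander projective dimension, then so has $N_2$; (2) if $N_2$ and $N_3$ have finite Auslander projective dimension, then so has $N_1$; (3) if $N_1$ and $N_2$ have finite Auslander projective dimension, then so has $N_3$. -/

import Mathlib

open CategoryTheory
open scoped TensorProduct

universe u

noncomputable section

namespace AuslanderPd

/-! A left `R`-, right `S`-bimodule `C` is encoded by `[Module R C] [Module Sᵐᵒᵖ C]` together with
`[SMulCommClass R Sᵐᵒᵖ C]`; the right action `c · s` is `MulOpposite.op s • c`. -/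

section Tensor

variable (R S C : Type u) [Ring R] [Ring S] [AddCommGroup C] [Module R C] [Module Sᵐᵒᵖ C]
  (N N' N'' : Type u) [AddCommGroup N] [Module S N] [AddCommGroup N'] [Module S N']
  [AddCommGroup N''] [Module S N'']

/-- The relations `c s ⊗ x = c ⊗ s x` that turn `C ⊗_ℤ N` into `C ⊗_S N`. (For an `(R,S)`-bimodule
the generating set is stable under `R`, so its `R`-span is the subgroup that it generates; see
`balancedRel_eq_closure`.) -/
def balancedRel : Submodule R (C ⊗[ℤ] N) :=
  Submodule.span R {t | ∃ (c : C) (s : S) (x : N),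
    t = (MulOpposite.op s • c) ⊗ₜ[ℤ] x - c ⊗ₜ[ℤ] (s • x)}

/-- The tensor product `C ⊗_S N` over the (not necessarily commutative) ring `S`, as a left
`R`-module. -/
abbrev BTensor : Type u := (C ⊗[ℤ] N) ⧸ balancedRel R S C N

variable {C N N' N''}

/-- The class `c ⊗ x` in `C ⊗_S N`. -/
def btmul (c : C) (x : N) : BTensor R S C N := Submodule.Quotient.mk (c ⊗ₜ[ℤ] x)

theorem btmul_add (c : C) (x y : N) :
    btmul R S c (x + y) = btmul R S c x + btmul R S c y := by
  simp [btmul, TensorProduct.tmul_add]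

theorem add_btmul (c d : C) (x : N) :
    btmul R S (c + d) x = btmul R S c x + btmul R S d x := by
  simp [btmul, TensorProduct.add_tmul]

theorem smul_btmul (r : R) (c : C) (x : N) :
    btmul R S (r • c) x = r • btmul R S c x := rfl

theorem btmul_balanced (c : C) (s : S) (x : N) :
    btmul R S (MulOpposite.op s • c) x = btmul R S c (s • x) :=
  (Submodule.Quotient.eq _).2 (Submodule.subset_span ⟨c, s, x, rfl⟩)

variable (C) in
theorem balancedRel_eq_closure [SMulCommClass R Sᵐᵒᵖ C] :
    (balancedRel R S C N).toAddSubgroup = AddSubgroup.closure {t | ∃ (c : C) (s : S) (x : N),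
      t = (MulOpposite.op s • c) ⊗ₜ[ℤ] x - c ⊗ₜ[ℤ] (s • x)} := by
  apply le_antisymm
  · intro t ht
    refine Submodule.span_induction (p := fun t _ => t ∈ AddSubgroup.closure _)
      (fun t ht => AddSubgroup.subset_closure ht) (zero_mem _)
      (fun _ _ _ _ h h' => add_mem h h') (fun r t ht' h => ?_) ht
    clear ht'
    induction h using AddSubgroup.closure_induction with
    | mem t ht =>
      obtain ⟨c, s, x, rfl⟩ := ht
      refine AddSubgroup.subset_closure ⟨r • c, s, x, ?_⟩
      rw [smul_sub, TensorProduct.smul_tmul', TensorProduct.smul_tmul', smul_comm]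
    | zero => simp
    | add _ _ _ _ h h' => rw [smul_add]; exact add_mem h h'
    | neg _ _ h => rw [smul_neg]; exact neg_mem h
  · rw [AddSubgroup.closure_le]
    exact Submodule.subset_span

/-- The map `C ⊗_S f : C ⊗_S N → C ⊗_S N'`, `c ⊗ x ↦ c ⊗ f x`. -/
def btensorMap (f : N →ₗ[S] N') : BTensor R S C N →ₗ[R] BTensor R S C N' :=
  Submodule.mapQ _ _
    (TensorProduct.AlgebraTensorModule.lTensor R C (f.toAddMonoidHom.toIntLinearMap)) (by
      rw [balancedRel, Submodule.span_le]
      rintro _ ⟨c, s, x, rfl⟩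
      refine Submodule.subset_span ⟨c, s, f x, ?_⟩
      simp)

@[simp]
theorem btensorMap_btmul (f : N →ₗ[S] N') (c : C) (x : N) :
    btensorMap R S f (btmul R S c x) = btmul R S c (f x) := rfl

theorem btensor_hom_ext {M : Type u} [AddCommGroup M] [Module R M]
    {f g : BTensor R S C N →ₗ[R] M}
    (h : ∀ c x, f (btmul R S c x) = g (btmul R S c x)) : f = g := by
  apply Submodule.linearMap_qext
  apply TensorProduct.AlgebraTensorModule.curry_injective
  ext c x
  exact h c x

variable (C) in
/-- The functor `C ⊗_S - : Mod S ⥤ Mod R`. -/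
def tensorFunctor : ModuleCat.{u} S ⥤ ModuleCat.{u} R where
  obj N := ModuleCat.of R (BTensor R S C N)
  map f := ModuleCat.ofHom (btensorMap R S f.hom)
  map_id N := by
    ext1
    exact btensor_hom_ext R S fun c x => rfl
  map_comp f g := by
    ext1
    exact btensor_hom_ext R S fun c x => rfl

instance tensorFunctor_additive : (tensorFunctor R S C).Additive where
  map_add {N N' f g} := by
    ext1
    exact btensor_hom_ext R S fun c x => btmul_add R S c (f.hom x) (g.hom x)

variable (C) in
/-- `Tor_i^S(C, -)`, the `i`-th left derived functor of `C ⊗_S -`. -/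
def torFunctor (i : ℕ) : ModuleCat.{u} S ⥤ ModuleCat.{u} R :=
  (tensorFunctor R S C).leftDerived i

/-- The canonical valuation homomorphism `μ_N : N → Hom_R(C, C ⊗_S N)`, `μ_N(x)(c) = c ⊗ x`. -/
def mu (x : N) : C →ₗ[R] BTensor R S C N where
  toFun c := btmul R S c x
  map_add' c d := add_btmul R S c d x
  map_smul' r c := smul_btmul R S r c x

theorem mu_add (x y : N) : mu R S (C := C) (x + y) = mu R S x + mu R S y :=
  LinearMap.ext fun c => btmul_add R S c x y

/-- `μ_N` is `S`-linear for the action `(s f)(c) = f(c s)` on `Hom_R(C, C ⊗_S N)`; hence it is an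
isomorphism of `S`-modules if and only if it is bijective. -/
theorem mu_smul (s : S) (x : N) (c : C) :
    mu R S (s • x) c = mu R S x (MulOpposite.op s • c) :=
  (btmul_balanced R S c s x).symm

end Tensor

section Semidualizing

/-- `M` admits a projective resolution by finitely generated projective modules. -/
def HasDegreewiseFiniteResolution (A : Type u) [Ring A] (M : Type u) [AddCommGroup M]
    [Module A M] : Prop :=
  ∃ P : ProjectiveResolution (ModuleCat.of A M), ∀ i, Module.Finite A (P.complex.X i)

variable (R S C : Type u) [Ring R] [Ring S] [AddCommGroup C] [Module R C] [Module Sᵐᵒᵖ C]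
  [SMulCommClass R Sᵐᵒᵖ C]

/-- The homothety `c ↦ r c`, an endomorphism of the right `S`-module `C`. -/
def homothetyLeft (r : R) : C →ₗ[Sᵐᵒᵖ] C where
  toFun c := r • c
  map_add' := smul_add r
  map_smul' s c := smul_comm r s c

/-- The homothety `c ↦ c s`, an endomorphism of the left `R`-module `C`. -/
def homothetyRight (s : S) : C →ₗ[R] C where
  toFun c := MulOpposite.op s • c
  map_add' := smul_add _
  map_smul' r c := (smul_comm r (MulOpposite.op s) c).symm

/-- The `(R,S)`-bimodule `C` is semidualizing. -/
structure IsSemidualizing : Prop where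
  finite_left : HasDegreewiseFiniteResolution R C
  finite_right : HasDegreewiseFiniteResolution Sᵐᵒᵖ C
  homothety_left : Function.Bijective (homothetyLeft R S C)
  homothety_right : Function.Bijective (homothetyRight R S C)
  ext_left : ∀ i : ℕ, 1 ≤ i →
    Subsingleton (Abelian.Ext.{u} (ModuleCat.of R C) (ModuleCat.of R C) i)
  ext_right : ∀ i : ℕ, 1 ≤ i →
    Subsingleton (Abelian.Ext.{u} (ModuleCat.of Sᵐᵒᵖ C) (ModuleCat.of Sᵐᵒᵖ C) i)

end Semidualizing

section Auslander

/-- The Auslander class `A_C(S)`, as a full subcategory of `Mod S`. -/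
structure auslanderClass (R S C : Type u) [Ring R] [Ring S] [AddCommGroup C] [Module R C]
    [Module Sᵐᵒᵖ C] (N : ModuleCat.{u} S) : Prop where
  tor_zero : ∀ i : ℕ, 1 ≤ i → Limits.IsZero ((torFunctor R S C i).obj N)
  ext_zero : ∀ i : ℕ, 1 ≤ i →
    Subsingleton (Abelian.Ext.{u} (ModuleCat.of R C) ((tensorFunctor R S C).obj N) i)
  mu_bijective : Function.Bijective (mu R S : N → (C →ₗ[R] BTensor R S C N))

variable {S : Type u} [Ring S]

/-- There is an exact sequence `0 → X n → ⋯ → X 1 → X 0 → N → 0` in `Mod S` with all `X i` in `P`.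
(It is continued to the left by zero modules, so that exactness at `X n` says that `X n → X (n-1)`,
or `X 0 → N` if `n = 0`, is injective.) -/
def HasResolutionOfLength (P : ObjectProperty (ModuleCat.{u} S)) (N : ModuleCat.{u} S)
    (n : ℕ) : Prop :=
  ∃ (X : ℕ → ModuleCat.{u} S) (d : ∀ i, X (i + 1) →ₗ[S] X i) (ε : X 0 →ₗ[S] N),
    (∀ i, i ≤ n → P (X i)) ∧ (∀ i, n < i → Subsingleton (X i)) ∧
    Function.Surjective ε ∧ Function.Exact (d 0) ε ∧
    ∀ i, Function.Exact (d (i + 1)) (d i)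

/-- The `P`-projective dimension of `N`: the infimum of the lengths of the finite resolutions of `N`
by modules in `P`, and `⊤` if there is none. -/
def relProjDim (P : ObjectProperty (ModuleCat.{u} S)) (N : ModuleCat.{u} S) : ℕ∞ :=
  sInf ((fun n : ℕ => (n : ℕ∞)) '' {n | HasResolutionOfLength P N n})

/-- The class of the `S`-modules of finite Auslander projective dimension with respect to `C`. -/
def finiteAuslanderPd (R S C : Type u) [Ring R] [Ring S] [AddCommGroup C] [Module R C]
    [Module Sᵐᵒᵖ C] : ObjectProperty (ModuleCat.{u} S) :=
  fun N => relProjDim (auslanderClass R S C) N < ⊤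

end Auslander

end AuslanderPd

end

/-! The argument has two independent halves.

Homological half: let `P` be a resolving class, that is, one containing the free modules and closed
under extensions and kernels of epimorphisms. A module has a finite resolution by `P` exactly when
some syzygy formed with free modules lies in `P` (`relProjDim_lt_top_iff`). Free covers can be
lifted, so the horseshoe lemma and Schanuel's argument apply to syzygies. The horseshoe gives
closure under extensions; cokernels reduce to extensions by passing to a free cover of the middle
term, and kernels reduce to both by Schanuel.

Module half: the Auslander class is resolving (`isResolving_auslanderClass`). With `C⁺` the
character module of `C`, vanishing of `Tor_i(C, N)` is vanishing of `Ext^i(N, C⁺)` for `i ≥ 1`, so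
both homological conditions are governed by long exact `Ext` sequences, and the condition on `μ` by
diagram chases. Free modules belong to the class because a map from a finitely generated module into
`C ⊗ F` meets finitely many copies of `C`, which reduces everything to `Ext^i(C, C) = 0` and
`End_R(C) = S`. -/

noncomputable section

namespace AuslanderPd

/-! ### Resolving classes, syzygies and finite resolutions. -/

section Resolving

variable {S : Type u} [Ring S]

/-- A class of modules that contains the free modules and is closed under extensions and under
kernels of epimorphisms. -/
structure IsResolving (P : ObjectProperty (ModuleCat.{u} S)) : Prop where
  free : ∀ (F : ModuleCat.{u} S), Module.Free S F → P F
  ext : ∀ {L M N : ModuleCat.{u} S} (f : L →ₗ[S] M) (g : M →ₗ[S] N), Function.Injective f →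
    Function.Exact f g → Function.Surjective g → P L → P N → P M
  ker : ∀ {L M N : ModuleCat.{u} S} (f : L →ₗ[S] M) (g : M →ₗ[S] N), Function.Injective f →
    Function.Exact f g → Function.Surjective g → P M → P N → P L

/-- Some `n`-th syzygy of `N`, formed with free modules, lies in `P`. -/
def HasSyzygyIn (P : ObjectProperty (ModuleCat.{u} S)) : ℕ → ModuleCat.{u} S → Prop
  | 0, N => P N
  | n + 1, N => ∃ (F : ModuleCat.{u} S) (p : F →ₗ[S] N), Module.Free S F ∧ Function.Surjective p ∧
      HasSyzygyIn P n (ModuleCat.of S (LinearMap.ker p))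

theorem exists_free_surjective (N : ModuleCat.{u} S) :
    ∃ (F : ModuleCat.{u} S) (p : F →ₗ[S] N), Module.Free S F ∧ Function.Surjective p :=
  ⟨ModuleCat.of S (N →₀ S), Finsupp.linearCombination S (id : N → N),
    inferInstanceAs (Module.Free S (N →₀ S)), Finsupp.linearCombination_id_surjective S N⟩

theorem exists_lift_of_free {F M N : Type u} [AddCommGroup F] [Module S F] [AddCommGroup M]
    [Module S M] [AddCommGroup N] [Module S N] (hF : Module.Free S F) (g : M →ₗ[S] N)
    (hg : Function.Surjective g) (p : F →ₗ[S] N) : ∃ q : F →ₗ[S] M, ∀ a, g (q a) = p a := by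
  obtain ⟨q, hq⟩ := Module.projective_lifting_property g p hg
  exact ⟨q, fun a => LinearMap.congr_fun hq a⟩

/-- The kernel of the canonical map `ker (g ∘ p) → ker g` is `ker p`. -/
theorem exists_ker_comp_sequence {F M N : Type u} [AddCommGroup F] [Module S F] [AddCommGroup M]
    [Module S M] [AddCommGroup N] [Module S N] (p : F →ₗ[S] M) (hp : Function.Surjective p)
    (g : M →ₗ[S] N) :
    ∃ (i : LinearMap.ker p →ₗ[S] LinearMap.ker (g ∘ₗ p))
      (q : LinearMap.ker (g ∘ₗ p) →ₗ[S] LinearMap.ker g),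
      Function.Injective i ∧ Function.Exact i q ∧ Function.Surjective q := by
  refine ⟨Submodule.inclusion (LinearMap.ker_le_ker_comp p g),
    p.restrict fun x hx => hx, Submodule.inclusion_injective _, ?_, ?_⟩
  · rintro ⟨x, hx⟩
    constructor
    · intro h
      exact ⟨⟨x, congrArg Subtype.val h⟩, rfl⟩
    · rintro ⟨⟨y, hy⟩, h⟩
      obtain rfl : y = x := congrArg Subtype.val h
      exact Subtype.ext hy
  · rintro ⟨y, hy⟩
    obtain ⟨x, rfl⟩ := hp y
    exact ⟨⟨x, hy⟩, rfl⟩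

/-- Schanuel's argument: if `0 → K → X → N → 0` is exact and `p : F → N` is an epimorphism from a
free module, then there is an exact sequence `0 → ker p → K × F → X → 0`. -/
theorem exists_schanuel_sequence {K X N F : Type u} [AddCommGroup K] [Module S K] [AddCommGroup X]
    [Module S X] [AddCommGroup N] [Module S N] [AddCommGroup F] [Module S F]
    (f : K →ₗ[S] X) (g : X →ₗ[S] N) (hf : Function.Injective f) (hfg : Function.Exact f g)
    (hg : Function.Surjective g) (hF : Module.Free S F) (p : F →ₗ[S] N)
    (hp : Function.Surjective p) :
    ∃ s : K × F →ₗ[S] X, Function.Surjective s ∧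
      Nonempty (LinearMap.ker s ≃ₗ[S] LinearMap.ker p) := by
  obtain ⟨q, hq⟩ := exists_lift_of_free hF g hg p
  let s : K × F →ₗ[S] X := LinearMap.coprod f q
  have hs : ∀ a b, s (a, b) = f a + q b := fun a b => by simp [s]
  have hgs : ∀ x, g (s x) = p x.2 := fun x => by
    rw [hs, map_add, hfg.apply_apply_eq_zero, hq, zero_add]
  -- Via `(a, b) ↦ (f a + q b, b)`, `K × F` is the pullback of `g` and `p`; its projection to `X` is
  -- `s`, with kernel `ker p`.
  have key : ∀ (x : X) (b : F), g x = p b → ∃ a, s (a, b) = x := fun x b h => by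
    obtain ⟨a, ha⟩ := (hfg (x - q b)).1 (by rw [map_sub, hq, h, sub_self])
    exact ⟨a, by rw [hs, ha, sub_add_cancel]⟩
  refine ⟨s, fun x => ?_, ⟨LinearEquiv.ofBijective
    ((LinearMap.snd S K F).restrict fun x hx => ?_) ⟨?_, ?_⟩⟩⟩
  · obtain ⟨b, hb⟩ := hp (g x)
    obtain ⟨a, ha⟩ := key x b hb.symm
    exact ⟨(a, b), ha⟩
  · rw [LinearMap.mem_ker] at hx ⊢
    rw [LinearMap.snd_apply, ← hgs, hx, map_zero]
  · rintro ⟨⟨a, b⟩, h⟩ ⟨⟨a', b'⟩, h'⟩ he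
    obtain rfl : b = b' := congrArg Subtype.val he
    rw [LinearMap.mem_ker, hs] at h h'
    obtain rfl : a = a' := hf (add_right_cancel (h.trans h'.symm))
    rfl
  · rintro ⟨b, hb⟩
    obtain ⟨a, ha⟩ := key 0 b (by rw [map_zero]; exact hb.symm)
    exact ⟨⟨(a, b), ha⟩, rfl⟩

variable {P : ObjectProperty (ModuleCat.{u} S)}

/-- `N` is the kernel of the epimorphism from `M` to the zero module, which is free. -/
theorem IsResolving.of_equiv (hP : IsResolving P) {M N : ModuleCat.{u} S} (e : M ≃ₗ[S] N)
    (hM : P M) : P N := by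
  refine hP.ker (N := ModuleCat.of S PUnit.{u + 1}) e.symm.toLinearMap 0 e.symm.injective ?_ ?_ hM
    (hP.free _ (inferInstanceAs (Module.Free S PUnit.{u + 1})))
  · intro x
    exact ⟨fun _ => ⟨e x, e.symm_apply_apply x⟩, fun _ => rfl⟩
  · exact fun x => ⟨0, rfl⟩

theorem HasSyzygyIn.of_equiv (hP : IsResolving P) {n : ℕ} {M N : ModuleCat.{u} S}
    (e : M ≃ₗ[S] N) (hM : HasSyzygyIn P n M) : HasSyzygyIn P n N := by
  cases n with
  | zero => exact hP.of_equiv e hM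
  | succ n =>
    obtain ⟨F, p, hF, hp, hK⟩ := hM
    refine ⟨F, e.toLinearMap ∘ₗ p, hF, e.surjective.comp hp, ?_⟩
    rwa [LinearEquiv.ker_comp]

theorem HasSyzygyIn.succ (hP : IsResolving P) {n : ℕ} {N : ModuleCat.{u} S}
    (hN : HasSyzygyIn P n N) : HasSyzygyIn P (n + 1) N := by
  induction n generalizing N with
  | zero =>
    obtain ⟨F, p, hF, hp⟩ := exists_free_surjective N
    exact ⟨F, p, hF, hp, hP.ker (LinearMap.ker p).subtype p Subtype.val_injective
      (LinearMap.exact_subtype_ker_map p) hp (hP.free F hF) hN⟩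
  | succ n ih =>
    obtain ⟨F, p, hF, hp, hK⟩ := hN
    exact ⟨F, p, hF, hp, ih hK⟩

theorem HasSyzygyIn.mono (hP : IsResolving P) {m n : ℕ} (hmn : m ≤ n) {N : ModuleCat.{u} S}
    (hN : HasSyzygyIn P m N) : HasSyzygyIn P n N := by
  induction hmn with
  | refl => exact hN
  | step _ ih => exact ih.succ hP

theorem IsResolving.hasSyzygyIn (hP : IsResolving P) (n : ℕ) {N : ModuleCat.{u} S}
    (hN : P N) : HasSyzygyIn P n N :=
  HasSyzygyIn.mono hP (Nat.zero_le n) hN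

/-- Horseshoe lemma: the free covers of `L` and `N` combine to one of `M`, and the three kernels
again form a short exact sequence. -/
theorem HasSyzygyIn.ext (hP : IsResolving P) {n : ℕ} {L M N : ModuleCat.{u} S}
    (f : L →ₗ[S] M) (g : M →ₗ[S] N) (hf : Function.Injective f) (hfg : Function.Exact f g)
    (hg : Function.Surjective g) (hL : HasSyzygyIn P n L) (hN : HasSyzygyIn P n N) :
    HasSyzygyIn P n M := by
  induction n generalizing L M N with
  | zero => exact hP.ext f g hf hfg hg hL hN
  | succ n ih =>
    obtain ⟨F, p, hF, hp, hK⟩ := hL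
    obtain ⟨G, q, hG, hq, hK'⟩ := hN
    obtain ⟨r, hr⟩ := exists_lift_of_free hG g hg q
    let s : F × G →ₗ[S] M := LinearMap.coprod (f ∘ₗ p) r
    have hs : ∀ a b, s (a, b) = f (p a) + r b := fun a b => by simp [s]
    have hgs : ∀ x, g (s x) = q x.2 := fun x => by
      rw [hs, map_add, hfg.apply_apply_eq_zero, hr, zero_add]
    have key : ∀ (m : M) (b : G), g m = q b → ∃ a, s (a, b) = m := fun m b h => by
      obtain ⟨y, hy⟩ := (hfg (m - r b)).1 (by rw [map_sub, hr, h, sub_self])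
      obtain ⟨a, rfl⟩ := hp y
      exact ⟨a, by rw [hs, hy, sub_add_cancel]⟩
    refine ⟨ModuleCat.of S (F × G), s, inferInstanceAs (Module.Free S (F × G)), fun m => ?_, ?_⟩
    · obtain ⟨b, hb⟩ := hq (g m)
      obtain ⟨a, ha⟩ := key m b hb.symm
      exact ⟨(a, b), ha⟩
    · refine ih (L := ModuleCat.of S (LinearMap.ker p)) (M := ModuleCat.of S (LinearMap.ker s))
        (N := ModuleCat.of S (LinearMap.ker q))
        ((LinearMap.inl S F G).restrict fun a ha => ?_)
        ((LinearMap.snd S F G).restrict fun x hx => ?_) ?_ ?_ ?_ hK hK'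
      · rw [LinearMap.mem_ker] at ha ⊢
        simp [hs, ha]
      · rw [LinearMap.mem_ker] at hx ⊢
        rw [LinearMap.snd_apply, ← hgs, hx, map_zero]
      · rintro ⟨a, ha⟩ ⟨b, hb⟩ h
        exact Subtype.ext (congrArg (fun x => x.1.1) h)
      · rintro ⟨⟨a, b⟩, hx⟩
        constructor
        · intro h
          obtain rfl : b = 0 := congrArg Subtype.val h
          refine ⟨⟨a, ?_⟩, rfl⟩
          rw [LinearMap.mem_ker, hs, map_zero, add_zero] at hx
          exact hf (hx.trans (map_zero f).symm)
        · rintro ⟨⟨a', ha'⟩, h⟩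
          exact Subtype.ext (congrArg (fun x => x.1.2) h).symm
      · rintro ⟨b, hb⟩
        obtain ⟨a, ha⟩ := key 0 b (by rw [map_zero]; exact hb.symm)
        exact ⟨⟨(a, b), ha⟩, rfl⟩

/-- The syzygy condition may be tested on a presentation by a module in `P`,
provided that kernels of epimorphisms onto modules in `P` are under control. -/
theorem HasSyzygyIn.coker_of_ker (hP : IsResolving P) {n : ℕ}
    (hker : ∀ {M N : ModuleCat.{u} S} (g : M →ₗ[S] N), Function.Surjective g →
      HasSyzygyIn P n M → P N → HasSyzygyIn P n (ModuleCat.of S (LinearMap.ker g)))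
    {K X N : ModuleCat.{u} S} (f : K →ₗ[S] X) (g : X →ₗ[S] N) (hf : Function.Injective f)
    (hfg : Function.Exact f g) (hg : Function.Surjective g) (hK : HasSyzygyIn P n K) (hX : P X) :
    HasSyzygyIn P (n + 1) N := by
  obtain ⟨F, p, hF, hp⟩ := exists_free_surjective N
  obtain ⟨s, hs, ⟨e⟩⟩ := exists_schanuel_sequence f g hf hfg hg hF p hp
  have hKF : HasSyzygyIn P n (ModuleCat.of S (K × F)) :=
    HasSyzygyIn.ext hP (N := F) (M := ModuleCat.of S (K × F)) (LinearMap.inl S K F)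
      (LinearMap.snd S K F) LinearMap.inl_injective Function.Exact.inl_snd
      LinearMap.snd_surjective hK (hP.hasSyzygyIn n (hP.free F hF))
  exact ⟨F, p, hF, hp, HasSyzygyIn.of_equiv hP e
    (hker (M := ModuleCat.of S (K × F)) s hs hKF hX)⟩

/-- For a free cover `p` of `M`, `ker g` is the quotient of `ker (g ∘ p)`, which lies in `P`, by
`ker p`, which has smaller index. The inductive hypothesis is thus what `coker_of_ker` needs to
raise the index back to `n + 1`. -/
theorem HasSyzygyIn.ker (hP : IsResolving P) {n : ℕ} {M N : ModuleCat.{u} S} (g : M →ₗ[S] N)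
    (hg : Function.Surjective g) (hM : HasSyzygyIn P n M) (hN : P N) :
    HasSyzygyIn P n (ModuleCat.of S (LinearMap.ker g)) := by
  induction n generalizing M N with
  | zero =>
    exact hP.ker (LinearMap.ker g).subtype g Subtype.val_injective
      (LinearMap.exact_subtype_ker_map g) hg hM hN
  | succ n ih =>
    obtain ⟨F, p, hF, hp, hK⟩ := hM
    obtain ⟨i, q, hi, hiq, hq⟩ := exists_ker_comp_sequence p hp g
    refine HasSyzygyIn.coker_of_ker hP ih (X := ModuleCat.of S (LinearMap.ker (g ∘ₗ p)))
      (K := ModuleCat.of S (LinearMap.ker p)) (N := ModuleCat.of S (LinearMap.ker g))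
      i q hi hiq hq hK ?_
    exact hP.ker (LinearMap.ker (g ∘ₗ p)).subtype (g ∘ₗ p) Subtype.val_injective
      (LinearMap.exact_subtype_ker_map _) (hg.comp hp) (hP.free F hF) hN

theorem HasSyzygyIn.coker (hP : IsResolving P) {n : ℕ} {K X N : ModuleCat.{u} S}
    (f : K →ₗ[S] X) (g : X →ₗ[S] N) (hf : Function.Injective f) (hfg : Function.Exact f g)
    (hg : Function.Surjective g) (hK : HasSyzygyIn P n K) (hX : P X) :
    HasSyzygyIn P (n + 1) N :=
  HasSyzygyIn.coker_of_ker hP (HasSyzygyIn.ker hP) f g hf hfg hg hK hX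

/-- The truncated complex resolves `ker ε` in length `n`, and `N` is the cokernel of `ker ε → X 0`
with `X 0` in `P`. -/
theorem HasResolutionOfLength.hasSyzygyIn (hP : IsResolving P) {n : ℕ} {N : ModuleCat.{u} S}
    (h : HasResolutionOfLength P N n) : HasSyzygyIn P n N := by
  induction n generalizing N with
  | zero =>
    obtain ⟨X, d, ε, hX, hX', hε, hdε, -⟩ := h
    have := hX' 1 zero_lt_one
    refine hP.of_equiv (LinearEquiv.ofBijective ε ⟨?_, hε⟩) (hX 0 le_rfl)
    rw [injective_iff_map_eq_zero]
    intro x hx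
    obtain ⟨y, rfl⟩ := (hdε x).1 hx
    rw [Subsingleton.elim y 0, map_zero]
  | succ n ih =>
    obtain ⟨X, d, ε, hX, hX', hε, hdε, hd⟩ := h
    refine HasSyzygyIn.coker hP (K := ModuleCat.of S (LinearMap.ker ε))
      (LinearMap.ker ε).subtype ε Subtype.val_injective (LinearMap.exact_subtype_ker_map ε) hε
      (ih ⟨fun i => X (i + 1), fun i => d (i + 1),
        (d 0).codRestrict (LinearMap.ker ε) fun x => hdε.apply_apply_eq_zero x,
        fun i hi => hX _ (by lia), fun i hi => hX' _ (by lia), ?_, ?_, fun i => hd (i + 1)⟩)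
      (hX 0 (Nat.zero_le _))
    · rintro ⟨x, hx⟩
      obtain ⟨y, rfl⟩ := (hdε x).1 hx
      exact ⟨y, rfl⟩
    · intro x
      rw [← hd 0 x, ← Subtype.val_inj]
      rfl

/-- Splicing the free covers gives a resolution whose last term is the syzygy in `P` and whose other
terms are free. -/
theorem HasSyzygyIn.hasResolutionOfLength (hP : IsResolving P) {n : ℕ} {N : ModuleCat.{u} S}
    (h : HasSyzygyIn P n N) : HasResolutionOfLength P N n := by
  induction n generalizing N with
  | zero =>
    refine ⟨fun i => Nat.casesOn i N fun _ => ModuleCat.of S PUnit,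
      fun _ => 0, LinearMap.id, fun i hi => ?_, fun i hi => ?_, Function.surjective_id,
      fun x => ?_, fun i x => ?_⟩
    · obtain rfl : i = 0 := by lia
      exact h
    · obtain ⟨i, rfl⟩ := Nat.exists_eq_succ_of_ne_zero hi.ne'
      exact inferInstanceAs (Subsingleton PUnit)
    · exact ⟨fun hx => ⟨0, hx.symm⟩, fun ⟨_, hx⟩ => hx.symm⟩
    · exact ⟨fun _ => ⟨0, rfl⟩, fun _ => rfl⟩
  | succ n ih =>
    obtain ⟨F, p, hF, hp, hK⟩ := h
    obtain ⟨X, d, ε, hX, hX', hε, hdε, hd⟩ := ih hK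
    refine ⟨fun i => Nat.casesOn i F X,
      fun i => match i with
        | 0 => (LinearMap.ker p).subtype ∘ₗ ε
        | i + 1 => d i,
      p, fun i hi => ?_, fun i hi => ?_, hp, fun x => ?_, fun i => ?_⟩
    · cases i with
      | zero => exact hP.free F hF
      | succ i => exact hX i (by lia)
    · cases i with
      | zero => exact absurd hi (by lia)
      | succ i => exact hX' i (by lia)
    · constructor
      · intro hx
        obtain ⟨y, hy⟩ := hε ⟨x, hx⟩
        exact ⟨y, congrArg Subtype.val hy⟩
      · rintro ⟨y, rfl⟩
        exact (ε y).2
    · cases i with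
      | zero =>
        intro x
        rw [← hdε x]
        exact Submodule.coe_eq_zero
      | succ i => exact hd i

theorem relProjDim_lt_top_iff (hP : IsResolving P) {N : ModuleCat.{u} S} :
    relProjDim P N < ⊤ ↔ ∃ n, HasSyzygyIn P n N := by
  rw [relProjDim, sInf_lt_iff]
  constructor
  · rintro ⟨_, ⟨n, hn, rfl⟩, -⟩
    exact ⟨n, HasResolutionOfLength.hasSyzygyIn hP hn⟩
  · rintro ⟨n, hn⟩
    exact ⟨n, ⟨n, hn.hasResolutionOfLength hP, rfl⟩, ENat.natCast_lt_top n⟩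

/-! ### Two out of three for finite dimension relative to a resolving class. -/

section TwoOutOfThree

variable {L M N : ModuleCat.{u} S} (f : L →ₗ[S] M) (g : M →ₗ[S] N)

theorem relProjDim_lt_top_ext (hP : IsResolving P) (hf : Function.Injective f)
    (hfg : Function.Exact f g) (hg : Function.Surjective g) (hL : relProjDim P L < ⊤)
    (hN : relProjDim P N < ⊤) : relProjDim P M < ⊤ := by
  rw [relProjDim_lt_top_iff hP] at *
  obtain ⟨m, hm⟩ := hL
  obtain ⟨n, hn⟩ := hN
  exact ⟨max m n, HasSyzygyIn.ext hP f g hf hfg hg (hm.mono hP (le_max_left _ _))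
    (hn.mono hP (le_max_right _ _))⟩

/-- For a free cover `F → M`, the kernel of `F → N` is an extension of `ker g ≅ L` by the kernel of
`F → M`. It is also a first syzygy of `N`. -/
theorem relProjDim_lt_top_coker (hP : IsResolving P) (hf : Function.Injective f)
    (hfg : Function.Exact f g) (hg : Function.Surjective g) (hL : relProjDim P L < ⊤)
    (hM : relProjDim P M < ⊤) : relProjDim P N < ⊤ := by
  obtain ⟨n, hn⟩ := (relProjDim_lt_top_iff hP).1 hM
  -- Raising the index to `n + 1` provides a free cover even if `n = 0`.
  obtain ⟨F, p, hF, hp, hK⟩ := hn.succ hP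
  obtain ⟨i, q, hi, hiq, hq⟩ := exists_ker_comp_sequence p hp g
  have e : L ≃ₗ[S] LinearMap.ker g :=
    (LinearEquiv.ofInjective f hf).trans (LinearEquiv.ofEq _ _ (hfg.linearMap_ker_eq).symm)
  have hkg : relProjDim P (ModuleCat.of S (LinearMap.ker g)) < ⊤ := by
    rw [relProjDim_lt_top_iff hP] at hL ⊢
    exact hL.imp fun m hm => hm.of_equiv hP e
  have hkp : relProjDim P (ModuleCat.of S (LinearMap.ker p)) < ⊤ :=
    (relProjDim_lt_top_iff hP).2 ⟨n, hK⟩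
  have hQ := relProjDim_lt_top_ext (M := ModuleCat.of S (LinearMap.ker (g ∘ₗ p))) i q hP hi hiq hq
    hkp hkg
  rw [relProjDim_lt_top_iff hP] at hQ ⊢
  obtain ⟨m, hm⟩ := hQ
  exact ⟨m + 1, F, g ∘ₗ p, hF, hg.comp hp, hm⟩

/-- For a free cover `p : F → N`, Schanuel makes `L × F` an extension of `M` by `ker p`; then `L` is
the cokernel of `F → L × F`. -/
theorem relProjDim_lt_top_ker (hP : IsResolving P) (hf : Function.Injective f)
    (hfg : Function.Exact f g) (hg : Function.Surjective g) (hM : relProjDim P M < ⊤)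
    (hN : relProjDim P N < ⊤) : relProjDim P L < ⊤ := by
  obtain ⟨n, hn⟩ := (relProjDim_lt_top_iff hP).1 hN
  obtain ⟨F, p, hF, hp, hK⟩ := hn.succ hP
  obtain ⟨s, hs, ⟨e⟩⟩ := exists_schanuel_sequence f g hf hfg hg hF p hp
  have hLF : relProjDim P (ModuleCat.of S (L × F)) < ⊤ :=
    relProjDim_lt_top_ext (L := ModuleCat.of S (LinearMap.ker s)) (M := ModuleCat.of S (L × F))
      (N := M) (LinearMap.ker s).subtype s hP Subtype.val_injective
      (LinearMap.exact_subtype_ker_map s) hs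
      ((relProjDim_lt_top_iff hP).2 ⟨n, hK.of_equiv hP e.symm⟩) hM
  exact relProjDim_lt_top_coker (L := F) (M := ModuleCat.of S (L × F)) (LinearMap.inr S L F)
    (LinearMap.fst S L F) hP LinearMap.inr_injective Function.Exact.inr_fst
    LinearMap.fst_surjective ((relProjDim_lt_top_iff hP).2 ⟨0, hP.free F hF⟩) hLF

end TwoOutOfThree

end Resolving

/-! ### Vanishing of `Ext`. -/

section Ext

variable {R : Type u} [Ring R]

/-- Computing the vanishing of `Ext` in positive degrees by a projective resolution. -/
theorem subsingleton_ext_succ_iff {X Y : ModuleCat.{u} R} (P : ProjectiveResolution X) (n : ℕ) :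
    Subsingleton (Abelian.Ext.{u} X Y (n + 1)) ↔
      ∀ f : P.complex.X (n + 1) ⟶ Y, P.complex.d (n + 2) (n + 1) ≫ f = 0 →
        ∃ g : P.complex.X n ⟶ Y, P.complex.d (n + 1) n ≫ g = f := by
  constructor
  · intro h f hf
    exact (P.extMk_eq_zero_iff f (n + 2) rfl hf n rfl).1 (Subsingleton.elim _ _)
  · refine fun h => subsingleton_of_forall_eq 0 fun α => ?_
    obtain ⟨f, hf, rfl⟩ := P.extMk_surjective α (n + 2) rfl
    exact (P.extMk_eq_zero_iff f (n + 2) rfl hf n rfl).2 (h f hf)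

/-- The obstruction to extending `φ` is its image under the connecting map into `Ext¹(N.X₃, Y)`. -/
theorem exists_extension_of_subsingleton_ext {N : ShortComplex (ModuleCat.{u} R)}
    (hN : N.ShortExact) {Y : ModuleCat.{u} R} (h : Subsingleton (Abelian.Ext.{u} N.X₃ Y 1))
    (φ : N.X₁ ⟶ Y) : ∃ ψ : N.X₂ ⟶ Y, N.f ≫ ψ = φ := by
  obtain ⟨x, hx⟩ := Abelian.Ext.contravariant_sequence_exact₁ hN Y (Abelian.Ext.mk₀ φ)
    (n₁ := 1) (add_zero 1) (Subsingleton.elim _ _)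
  obtain ⟨ψ, rfl⟩ := Abelian.Ext.addEquiv₀.symm.surjective x
  refine ⟨ψ, Abelian.Ext.addEquiv₀.symm.injective ?_⟩
  simpa using hx

end Ext

/-! ### Characters and the dual of a right module. -/

section Character

/-- Exactness can be tested on characters. -/
theorem exact_iff_forall_character {A B D : Type*} [AddCommGroup A] [AddCommGroup B]
    [AddCommGroup D] (f : A →+ B) (g : B →+ D) (hfg : ∀ a, g (f a) = 0) :
    Function.Exact f g ↔ ∀ χ : CharacterModule B, (∀ a, χ (f a) = 0) →
      ∃ ψ : CharacterModule D, ∀ b, ψ (g b) = χ b := by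
  constructor
  · intro h χ hχ
    have hker : g.ker ≤ AddMonoidHom.ker (χ : B →+ AddCircle (1 : ℚ)) := by
      intro b hb
      obtain ⟨a, rfl⟩ := (h b).1 hb
      exact hχ a
    obtain ⟨ψ, hψ⟩ := CharacterModule.dual_surjective_of_injective
      (QuotientAddGroup.kerLift g).toIntLinearMap (QuotientAddGroup.kerLift_injective g)
      (QuotientAddGroup.lift g.ker (χ : B →+ AddCircle (1 : ℚ)) hker)
    exact ⟨ψ, fun b => DFunLike.congr_fun hψ (QuotientAddGroup.mk b)⟩
  · intro h b
    refine ⟨fun hb => ?_, fun ⟨a, ha⟩ => ha ▸ hfg a⟩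
    rw [← AddMonoidHom.coe_range, SetLike.mem_coe, ← QuotientAddGroup.eq_zero_iff]
    -- A character of `B / range f`, pulled back to `B`, factors through `g` and so kills `b`;
    -- characters separate points.
    refine CharacterModule.eq_zero_of_character_apply fun c => ?_
    obtain ⟨ψ, hψ⟩ := h (AddMonoidHom.comp c (QuotientAddGroup.mk' f.range)) fun a => by
      have : (QuotientAddGroup.mk' f.range) (f a) = 0 :=
        (QuotientAddGroup.eq_zero_iff _).2 ⟨a, rfl⟩
      exact (congrArg c this).trans (map_zero c)
    exact (hψ b).symm.trans ((congrArg ψ hb).trans (map_zero ψ))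

/-- The character module of the right `S`-module `C`, a left `S`-module by `(s φ)(c) = φ(c s)`. -/
@[nolint unusedArguments]
def RightDual (S C : Type u) [Ring S] [AddCommGroup C] [Module Sᵐᵒᵖ C] : Type u :=
  C →+ AddCircle (1 : ℚ)

variable (S C : Type u) [Ring S] [AddCommGroup C] [Module Sᵐᵒᵖ C]

instance : AddCommGroup (RightDual S C) := inferInstanceAs (AddCommGroup (C →+ AddCircle (1 : ℚ)))

instance : FunLike (RightDual S C) C (AddCircle (1 : ℚ)) :=
  inferInstanceAs (FunLike (C →+ AddCircle (1 : ℚ)) C (AddCircle (1 : ℚ)))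

instance : AddMonoidHomClass (RightDual S C) C (AddCircle (1 : ℚ)) :=
  inferInstanceAs (AddMonoidHomClass (C →+ AddCircle (1 : ℚ)) C (AddCircle (1 : ℚ)))

instance : Module S (RightDual S C) where
  smul s φ := AddMonoidHom.comp φ (DistribSMul.toAddMonoidHom C (MulOpposite.op s))
  one_smul φ := DFunLike.ext _ _ fun c => congrArg φ (one_smul _ c)
  mul_smul s t φ := DFunLike.ext _ _ fun c => congrArg φ (mul_smul (MulOpposite.op t) _ c)
  smul_zero _ := rfl
  smul_add _ _ _ := rfl
  add_smul s t φ := DFunLike.ext _ _ fun c => by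
    refine (congrArg φ (?_ : MulOpposite.op (s + t) • c =
      MulOpposite.op s • c + MulOpposite.op t • c)).trans (map_add φ _ _)
    rw [MulOpposite.op_add, add_smul]
  zero_smul φ := DFunLike.ext _ _ fun c => by
    refine (congrArg φ (?_ : MulOpposite.op (0 : S) • c = 0)).trans (map_zero φ)
    rw [MulOpposite.op_zero, zero_smul]

end Character

/-! ### The duality between `C ⊗_S -` and `Hom_S(-, C⁺)`. -/

section TensorHom

variable {R S C : Type u} [Ring R] [Ring S] [AddCommGroup C] [Module R C] [Module Sᵐᵒᵖ C]
  {N N' N'' : Type u} [AddCommGroup N] [Module S N] [AddCommGroup N'] [Module S N']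
  [AddCommGroup N''] [Module S N'']

theorem btensor_induction {p : BTensor R S C N → Prop} (h : ∀ c x, p (btmul R S c x))
    (hadd : ∀ a b, p a → p b → p (a + b)) (t : BTensor R S C N) : p t := by
  obtain ⟨t, rfl⟩ := Submodule.Quotient.mk_surjective _ t
  induction t with
  | zero =>
    rw [← TensorProduct.zero_tmul C (0 : N)]
    exact h 0 0
  | tmul c x => exact h c x
  | add a b ha hb => exact hadd _ _ ha hb

theorem btmul_zero (c : C) : btmul R S c (0 : N) = 0 := by simp [btmul]

theorem btensorMap_surjective (g : N →ₗ[S] N') (hg : Function.Surjective g) :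
    Function.Surjective (btensorMap R S (C := C) g) := by
  intro t
  induction t using btensor_induction with
  | h c x =>
    obtain ⟨y, rfl⟩ := hg x
    exact ⟨btmul R S c y, rfl⟩
  | hadd a b ha hb =>
    obtain ⟨a, rfl⟩ := ha
    obtain ⟨b, rfl⟩ := hb
    exact ⟨a + b, map_add _ _ _⟩

variable (R) in
/-- A character of `C ⊗_S N` is an `S`-linear map from `N` to the character module of `C`. -/
def characterCurry (χ : CharacterModule (BTensor R S C N)) : N →ₗ[S] RightDual S C where
  toFun x := AddMonoidHom.comp χ (mu R S x).toAddMonoidHom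
  map_add' x y := DFunLike.ext _ _ fun c => (congrArg χ (btmul_add R S c x y)).trans (map_add χ _ _)
  map_smul' s x := DFunLike.ext _ _ fun c => congrArg χ (mu_smul R S s x c)

variable [SMulCommClass R Sᵐᵒᵖ C]

variable (R) in
theorem exists_characterUncurry (φ : N →ₗ[S] RightDual S C) :
    ∃ χ : CharacterModule (BTensor R S C N), ∀ c x, χ (btmul R S c x) = φ x c := by
  let l : C ⊗[ℤ] N →+ AddCircle (1 : ℚ) := TensorProduct.liftAddHom
    (AddMonoidHom.flip ⟨⟨fun x => (φ x : C →+ AddCircle (1 : ℚ)), map_zero φ⟩, map_add φ⟩)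
    fun r c x => by
      change φ x (r • c) = φ (r • x) c
      rw [map_zsmul, map_zsmul]
      rfl
  -- `l` is merely additive, so the relations have to be generated as a subgroup and not as an
  -- `R`-submodule.
  have hl : ∀ t ∈ (balancedRel R S C N).toAddSubgroup, l t = 0 := by
    rw [balancedRel_eq_closure]
    change _ ≤ l.ker
    rw [AddSubgroup.closure_le]
    rintro _ ⟨c, s, x, rfl⟩
    rw [SetLike.mem_coe, AddMonoidHom.mem_ker, map_sub, sub_eq_zero]
    change φ x (MulOpposite.op s • c) = φ (s • x) c
    exact (DFunLike.congr_fun (φ.map_smul s x) c).symm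
  exact ⟨QuotientAddGroup.lift (balancedRel R S C N).toAddSubgroup l hl, fun c x => rfl⟩

/-- The adjunction between `C ⊗_S -` and the character module of `C`, on sequences: exactness of
`C ⊗_S N → C ⊗_S N' → C ⊗_S N''` means that every `N' → C⁺` that vanishes on `N` extends along
`N' → N''`. -/
theorem btensorMap_exact_iff (f : N →ₗ[S] N') (g : N' →ₗ[S] N'') (hfg : g ∘ₗ f = 0) :
    Function.Exact (btensorMap R S (C := C) f) (btensorMap R S (C := C) g) ↔
      ∀ φ : N' →ₗ[S] RightDual S C, φ ∘ₗ f = 0 → ∃ ψ : N'' →ₗ[S] RightDual S C, ψ ∘ₗ g = φ := by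
  have h0 : ∀ t, btensorMap R S (C := C) g (btensorMap R S f t) = 0 := by
    have : btensorMap R S (C := C) g ∘ₗ btensorMap R S f = 0 :=
      btensor_hom_ext R S fun c x => by
        have := LinearMap.congr_fun hfg x
        rw [LinearMap.comp_apply, LinearMap.zero_apply] at this
        simp [this, btmul_zero]
    exact LinearMap.congr_fun this
  refine (exact_iff_forall_character (btensorMap R S (C := C) f).toAddMonoidHom
    (btensorMap R S (C := C) g).toAddMonoidHom h0).trans ⟨fun h φ hφ => ?_, fun h χ hχ => ?_⟩
  · obtain ⟨χ, hχ⟩ := exists_characterUncurry R φ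
    obtain ⟨ψ, hψ⟩ := h χ fun t => by
      induction t using btensor_induction with
      | h c x =>
        have := LinearMap.congr_fun hφ x
        rw [LinearMap.comp_apply, LinearMap.zero_apply] at this
        exact (hχ c (f x)).trans (DFunLike.congr_fun this c)
      | hadd a b ha hb => rw [map_add, map_add, ha, hb, add_zero]
    refine ⟨characterCurry R ψ, LinearMap.ext fun x => DFunLike.ext _ _ fun c => ?_⟩
    exact (hψ (btmul R S c x)).trans (hχ c x)
  · obtain ⟨ψ, hψ⟩ := h (characterCurry R χ) (LinearMap.ext fun x => DFunLike.ext _ _ fun c =>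
      hχ (btmul R S c x))
    obtain ⟨χ', hχ'⟩ := exists_characterUncurry R ψ
    refine ⟨χ', fun t => ?_⟩
    induction t using btensor_induction with
    | h c x => exact (hχ' c (g x)).trans (DFunLike.congr_fun (LinearMap.congr_fun hψ x) c)
    | hadd a b ha hb => rw [map_add, map_add, map_add, ha, hb]

theorem btensorMap_exact (f : N →ₗ[S] N') (g : N' →ₗ[S] N'') (hfg : Function.Exact f g)
    (hg : Function.Surjective g) :
    Function.Exact (btensorMap R S (C := C) f) (btensorMap R S (C := C) g) := by
  rw [btensorMap_exact_iff f g hfg.linearMap_comp_eq_zero]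
  intro φ hφ
  have hker : LinearMap.ker g ≤ LinearMap.ker φ := by
    rw [hfg.linearMap_ker_eq]
    rintro _ ⟨x, rfl⟩
    exact LinearMap.congr_fun hφ x
  refine ⟨(LinearMap.ker g).liftQ φ hker ∘ₗ (g.quotKerEquivOfSurjective hg).symm.toLinearMap,
    LinearMap.ext fun x => ?_⟩
  have : (g.quotKerEquivOfSurjective hg).symm (g x) = (LinearMap.ker g).mkQ x := by
    rw [LinearEquiv.symm_apply_eq]
    rfl
  simp [this]

/-- Injectivity is exactness of `0 → C ⊗ N → C ⊗ N'`, tested by the duality on the sequence `0 → N →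
N'`. -/
theorem btensorMap_injective (f : N →ₗ[S] N')
    (h : ∀ φ : N →ₗ[S] RightDual S C, ∃ ψ : N' →ₗ[S] RightDual S C, ψ ∘ₗ f = φ) :
    Function.Injective (btensorMap R S (C := C) f) := by
  have h0 : (f ∘ₗ (0 : PUnit.{u + 1} →ₗ[S] N)) = 0 := LinearMap.comp_zero f
  have := (btensorMap_exact_iff (R := R) (C := C) _ f h0).2 fun φ _ => h φ
  rw [injective_iff_map_eq_zero]
  intro t ht
  obtain ⟨s, rfl⟩ := (this t).1 ht
  induction s using btensor_induction with
  | h c x => exact btmul_zero c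
  | hadd a b ha hb =>
    have : Subsingleton (BTensor R S C PUnit.{u + 1}) := ⟨fun a b => by
      suffices ∀ a : BTensor R S C PUnit.{u + 1}, a = 0 by rw [this a, this b]
      intro a
      induction a using btensor_induction with
      | h c x => exact btmul_zero c
      | hadd a b ha hb => rw [ha, hb, add_zero]⟩
    rw [Subsingleton.elim (a + b) 0, map_zero]

/-- `Tor_i^S(C, N)` vanishes in positive degrees if and only if `Ext^i_S(N, C⁺)` does. -/
theorem isZero_tor_iff (N : ModuleCat.{u} S) (n : ℕ) :
    Limits.IsZero ((torFunctor R S C (n + 1)).obj N) ↔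
      Subsingleton (Abelian.Ext.{u} N (ModuleCat.of S (RightDual S C)) (n + 1)) := by
  let P := projectiveResolution N
  rw [subsingleton_ext_succ_iff P, torFunctor,
    (P.isoLeftDerivedObj (tensorFunctor R S C) (n + 1)).isZero_iff]
  change Limits.IsZero (HomologicalComplex.homology _ (n + 1)) ↔ _
  rw [← HomologicalComplex.exactAt_iff_isZero_homology,
    HomologicalComplex.exactAt_iff' _ (n + 2) (n + 1) n (by simp only [ChainComplex.prev]; rfl)
      (by simp), ShortComplex.ShortExact.moduleCat_exact_iff_function_exact]
  -- Both sides now say that each map `P_{n+1} → C⁺` vanishing on the image of `P_{n+2}` factors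
  -- through `P_{n+1} → P_n`.
  refine (btensorMap_exact_iff (P.complex.d (n + 2) (n + 1)).hom (P.complex.d (n + 1) n).hom
    ?_).trans ⟨fun h f hf => ?_, fun h φ hφ => ?_⟩
  · rw [← ModuleCat.hom_comp, P.complex.d_comp_d]
    rfl
  · obtain ⟨ψ, hψ⟩ := h f.hom (by rw [← ModuleCat.hom_comp, hf]; rfl)
    exact ⟨ModuleCat.ofHom ψ, ModuleCat.hom_ext hψ⟩
  · obtain ⟨ψ, hψ⟩ := h (ModuleCat.ofHom φ) (ModuleCat.hom_ext hφ)
    exact ⟨ψ.hom, congrArg ModuleCat.Hom.hom hψ⟩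

end TensorHom

/-! ### The Auslander class in short exact sequences. -/

section Sequences

variable {R S C : Type u} [Ring R] [Ring S] [AddCommGroup C] [Module R C] [Module Sᵐᵒᵖ C]

theorem btensorMap_mu {N N' : Type u} [AddCommGroup N] [Module S N] [AddCommGroup N']
    [Module S N'] (f : N →ₗ[S] N') (x : N) :
    btensorMap R S f ∘ₗ mu R S (C := C) x = mu R S (f x) := rfl

theorem mu_zero {N : Type u} [AddCommGroup N] [Module S N] :
    mu R S (C := C) (0 : N) = 0 := LinearMap.ext fun c => btmul_zero c

theorem mu_injective_iff {N : Type u} [AddCommGroup N] [Module S N] :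
    Function.Injective (mu R S : N → (C →ₗ[R] BTensor R S C N)) ↔
      ∀ x : N, mu R S (C := C) x = 0 → x = 0 :=
  injective_iff_map_eq_zero (⟨⟨mu R S, mu_zero⟩, mu_add R S⟩ : N →+ (C →ₗ[R] BTensor R S C N))

theorem exists_factor_of_exact {A B D E : Type*} [AddCommGroup A] [Module R A] [AddCommGroup B]
    [Module R B] [AddCommGroup D] [Module R D] [AddCommGroup E] [Module R E] {f : A →ₗ[R] B}
    {g : B →ₗ[R] D} (hf : Function.Injective f) (hfg : Function.Exact f g) (h : E →ₗ[R] B)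
    (hh : g ∘ₗ h = 0) : ∃ k : E →ₗ[R] A, f ∘ₗ k = h := by
  refine ⟨(LinearEquiv.ofInjective f hf).symm.toLinearMap ∘ₗ
    h.codRestrict (LinearMap.range f) fun x => (hfg _).1 (LinearMap.congr_fun hh x),
    LinearMap.ext fun x => ?_⟩
  exact congrArg Subtype.val ((LinearEquiv.ofInjective f hf).apply_symm_apply _)

variable [SMulCommClass R Sᵐᵒᵖ C] {N : ShortComplex (ModuleCat.{u} S)}

theorem tor_zero_iff {N : ModuleCat.{u} S} :
    (∀ i : ℕ, 1 ≤ i → Limits.IsZero ((torFunctor R S C i).obj N)) ↔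
      ∀ i : ℕ, 1 ≤ i →
        Subsingleton (Abelian.Ext.{u} N (ModuleCat.of S (RightDual S C)) i) := by
  refine forall₂_congr fun i hi => ?_
  obtain ⟨i, rfl⟩ := Nat.exists_eq_add_of_le' hi
  exact isZero_tor_iff N i

theorem shortExact_map_tensorFunctor (hN : N.ShortExact)
    (h : Subsingleton (Abelian.Ext.{u} N.X₃ (ModuleCat.of S (RightDual S C)) 1)) :
    (N.map (tensorFunctor R S C)).ShortExact := by
  refine ModuleCat.shortComplex_shortExact _ ?_ ?_ ?_
  · exact btensorMap_exact N.f.hom N.g.hom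
      ((ShortComplex.ShortExact.moduleCat_exact_iff_function_exact N).1 hN.exact)
      hN.moduleCat_surjective_g
  · refine btensorMap_injective N.f.hom fun φ => ?_
    obtain ⟨ψ, hψ⟩ := exists_extension_of_subsingleton_ext hN h (ModuleCat.ofHom φ)
    exact ⟨ψ.hom, congrArg ModuleCat.Hom.hom hψ⟩
  · exact btensorMap_surjective N.g.hom hN.moduleCat_surjective_g

theorem auslanderClass.ext_one (h : auslanderClass R S C N.X₃) :
    Subsingleton (Abelian.Ext.{u} N.X₃ (ModuleCat.of S (RightDual S C)) 1) :=
  tor_zero_iff.1 h.tor_zero 1 le_rfl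

theorem auslanderClass.extension (hN : N.ShortExact) (h₁ : auslanderClass R S C N.X₁)
    (h₃ : auslanderClass R S C N.X₃) : auslanderClass R S C N.X₂ := by
  have hT := shortExact_map_tensorFunctor (R := R) hN h₃.ext_one
  have hex := (ShortComplex.ShortExact.moduleCat_exact_iff_function_exact N).1 hN.exact
  have hTex := (ShortComplex.ShortExact.moduleCat_exact_iff_function_exact _).1 hT.exact
  refine ⟨tor_zero_iff.2 fun i hi => ?_, fun i hi => ?_, mu_injective_iff.2 fun x hx => ?_,
    fun φ => ?_⟩
  · have := tor_zero_iff.1 h₁.tor_zero i hi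
    have := tor_zero_iff.1 h₃.tor_zero i hi
    refine subsingleton_of_forall_eq 0 fun x => ?_
    obtain ⟨y, rfl⟩ := Abelian.Ext.contravariant_sequence_exact₂ hN _ x (Subsingleton.elim _ _)
    rw [Subsingleton.elim y 0, Abelian.Ext.comp_zero]
  · have : Subsingleton (Abelian.Ext _ (N.map (tensorFunctor R S C)).X₁ i) := h₁.ext_zero i hi
    have : Subsingleton (Abelian.Ext _ (N.map (tensorFunctor R S C)).X₃ i) := h₃.ext_zero i hi
    change Subsingleton (Abelian.Ext _ (N.map (tensorFunctor R S C)).X₂ i)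
    refine subsingleton_of_forall_eq 0 fun x => ?_
    obtain ⟨y, rfl⟩ := Abelian.Ext.covariant_sequence_exact₂ _ hT x
      (Subsingleton.elim _ _)
    rw [Subsingleton.elim y 0, Abelian.Ext.zero_comp]
  · obtain ⟨y, rfl⟩ := (hex x).1 (mu_injective_iff.1 h₃.mu_bijective.1 _ (by
      rw [← btensorMap_mu, hx, LinearMap.comp_zero]))
    rw [mu_injective_iff.1 h₁.mu_bijective.1 y, map_zero]
    refine LinearMap.ext fun c => hT.moduleCat_injective_f ?_
    exact (LinearMap.congr_fun hx c).trans (map_zero _).symm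
  -- Surjectivity as in the five lemma: correct `φ` by some `μ(x)` so that it lands in `C ⊗ N.X₁`,
  -- and use `h₁` there.
  · obtain ⟨z, hz⟩ := h₃.mu_bijective.2 (btensorMap R S N.g.hom ∘ₗ φ)
    obtain ⟨x, rfl⟩ := hN.moduleCat_surjective_g z
    obtain ⟨k, hk⟩ := exists_factor_of_exact hT.moduleCat_injective_f hTex (φ - mu R S x)
      (by
        change btensorMap R S N.g.hom ∘ₗ (φ - mu R S x) = 0
        rw [LinearMap.comp_sub, ← hz, btensorMap_mu, sub_self])
    obtain ⟨y, rfl⟩ := h₁.mu_bijective.2 k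
    refine ⟨N.f.hom y + x, ?_⟩
    rw [mu_add, ← btensorMap_mu]
    exact sub_eq_iff_eq_add.1 hk.symm |>.symm

theorem auslanderClass.kernel (hN : N.ShortExact) (h₂ : auslanderClass R S C N.X₂)
    (h₃ : auslanderClass R S C N.X₃) : auslanderClass R S C N.X₁ := by
  have hT := shortExact_map_tensorFunctor (R := R) hN h₃.ext_one
  have hex := (ShortComplex.ShortExact.moduleCat_exact_iff_function_exact N).1 hN.exact
  refine ⟨tor_zero_iff.2 fun i hi => ?_, fun i hi => ?_, mu_injective_iff.2 fun x hx => ?_,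
    fun φ => ?_⟩
  · have := tor_zero_iff.1 h₂.tor_zero i hi
    have := tor_zero_iff.1 h₃.tor_zero (1 + i) (by lia)
    refine subsingleton_of_forall_eq 0 fun x => ?_
    obtain ⟨y, rfl⟩ := Abelian.Ext.contravariant_sequence_exact₁ hN _ x rfl
      (Subsingleton.elim _ _)
    rw [Subsingleton.elim y 0, Abelian.Ext.comp_zero]
  · obtain ⟨i, rfl⟩ := Nat.exists_eq_add_of_le' hi
    have : Subsingleton (Abelian.Ext _ (N.map (tensorFunctor R S C)).X₂ (i + 1)) :=
      h₂.ext_zero (i + 1) hi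
    change Subsingleton (Abelian.Ext _ (N.map (tensorFunctor R S C)).X₁ (i + 1))
    refine subsingleton_of_forall_eq 0 fun x => ?_
    obtain ⟨y, rfl⟩ := Abelian.Ext.covariant_sequence_exact₁ _ hT x
      (Subsingleton.elim _ _) rfl
    cases i with
    | zero =>
      -- `Ext¹` is not covered by vanishing at `N.X₃`. Instead each `φ : C → C ⊗ N.X₃` is some
      -- `μ(z)`; lifting `z` to `N.X₂` lifts `φ`, so its connecting image is zero.
      obtain ⟨φ, rfl⟩ := Abelian.Ext.addEquiv₀.symm.surjective y
      obtain ⟨z, hz⟩ := h₃.mu_bijective.2 φ.hom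
      obtain ⟨x, rfl⟩ := hN.moduleCat_surjective_g z
      obtain ⟨m, rfl⟩ : ∃ m : ModuleCat.of R C ⟶ (N.map (tensorFunctor R S C)).X₂,
          m ≫ (N.map (tensorFunctor R S C)).g = φ :=
        ⟨ModuleCat.ofHom (mu R S x), ModuleCat.hom_ext hz⟩
      rw [Abelian.Ext.addEquiv₀_symm_apply, ← Abelian.Ext.mk₀_comp_mk₀,
        Abelian.Ext.comp_assoc_of_second_deg_zero, hT.comp_extClass, Abelian.Ext.comp_zero]
    | succ i =>
      have : Subsingleton (Abelian.Ext _ (N.map (tensorFunctor R S C)).X₃ (i + 1)) :=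
        h₃.ext_zero (i + 1) (by lia)
      rw [Subsingleton.elim y 0, Abelian.Ext.zero_comp]
  · refine hN.moduleCat_injective_f ?_
    rw [map_zero]
    refine mu_injective_iff.1 h₂.mu_bijective.1 _ ?_
    rw [← btensorMap_mu, hx, LinearMap.comp_zero]
  · obtain ⟨x, hx⟩ := h₂.mu_bijective.2 (btensorMap R S N.f.hom ∘ₗ φ)
    have hTz : btensorMap R S (C := C) N.g.hom ∘ₗ btensorMap R S N.f.hom = 0 :=
      congrArg ModuleCat.Hom.hom (N.map (tensorFunctor R S C)).zero
    obtain ⟨y, rfl⟩ := (hex x).1 (mu_injective_iff.1 h₃.mu_bijective.1 _ (by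
      rw [← btensorMap_mu, hx, ← LinearMap.comp_assoc, hTz, LinearMap.zero_comp]))
    refine ⟨y, LinearMap.ext fun c => hT.moduleCat_injective_f ?_⟩
    exact LinearMap.congr_fun hx c

end Sequences

/-! ### Free modules belong to the Auslander class. -/

section Free

variable {R S C : Type u} [Ring R] [Ring S] [AddCommGroup C] [Module R C] [Module Sᵐᵒᵖ C]
  {N : Type u} [AddCommGroup N] [Module S N]

/-- A map from a finitely generated module to a module `Y` that is locally a finite sum of copies
of `Z` (as witnessed by `ι` and `π`) meets finitely many of them. -/
theorem exists_finset_sum_eq {J Z Y M : Type u} [AddCommGroup Z] [Module R Z] [AddCommGroup Y]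
    [Module R Y] [AddCommGroup M] [Module R M] [Module.Finite R M] {ι : J → Z →ₗ[R] Y}
    {π : J → Y →ₗ[R] Z}
    (h : ∀ y, ∃ s : Finset J, ∀ t, s ⊆ t → ∑ j ∈ t, ι j (π j y) = y) (f : M →ₗ[R] Y) :
    ∃ s : Finset J, ∑ j ∈ s, ι j ∘ₗ π j ∘ₗ f = f := by
  classical
  obtain ⟨T, hT⟩ := Module.Finite.fg_top (R := R) (M := M)
  choose s hs using h
  refine ⟨T.biUnion fun m => s (f m), LinearMap.ext_on hT fun m hm => ?_⟩
  rw [LinearMap.sum_apply]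
  exact hs (f m) _ (Finset.subset_biUnion_of_mem (fun m => s (f m)) hm)

/-- A cocycle on the finitely generated `P_{n+1}` is a finite sum of cocycles with values in `Z`,
each of them a coboundary. -/
theorem subsingleton_ext_of_locally_sum {X Z Y : ModuleCat.{u} R} (P : ProjectiveResolution X)
    (hP : ∀ i, Module.Finite R (P.complex.X i)) {J : Type u} {ι : J → Z →ₗ[R] Y}
    {π : J → Y →ₗ[R] Z} (h : ∀ y, ∃ s : Finset J, ∀ t, s ⊆ t → ∑ j ∈ t, ι j (π j y) = y) (n : ℕ)
    (hZ : Subsingleton (Abelian.Ext.{u} X Z (n + 1))) :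
    Subsingleton (Abelian.Ext.{u} X Y (n + 1)) := by
  rw [subsingleton_ext_succ_iff P] at hZ ⊢
  intro f hf
  have := hP (n + 1)
  obtain ⟨s, hs⟩ := exists_finset_sum_eq h f.hom
  choose g hg using fun j => hZ (f ≫ ModuleCat.ofHom (π j)) (by rw [reassoc_of% hf]; simp)
  refine ⟨∑ j ∈ s, g j ≫ ModuleCat.ofHom (ι j), ?_⟩
  rw [Preadditive.comp_sum]
  simp_rw [reassoc_of% hg]
  ext x
  refine Eq.trans ?_ (LinearMap.congr_fun hs x)
  simp [ModuleCat.hom_sum]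

variable [SMulCommClass R Sᵐᵒᵖ C]

/-- The map `C ⊗_S N → C`, `c ⊗ x ↦ c φ(x)`, defined by a linear form `φ` on `N`. -/
theorem exists_btensor_eval (φ : N →ₗ[S] S) :
    ∃ π : BTensor R S C N →ₗ[R] C, ∀ c x, π (btmul R S c x) = MulOpposite.op (φ x) • c := by
  let l : C →ₗ[R] N →ₗ[ℤ] C :=
    { toFun c := AddMonoidHom.toIntLinearMap
        ⟨⟨fun x => MulOpposite.op (φ x) • c, by simp⟩, fun x y => by simp [add_smul]⟩
      map_add' c d := LinearMap.ext fun x => smul_add _ c d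
      map_smul' r c := LinearMap.ext fun x => (smul_comm r (MulOpposite.op (φ x)) c).symm }
  refine ⟨Submodule.liftQ _ (TensorProduct.AlgebraTensorModule.lift l) ?_, fun c x => rfl⟩
  rw [balancedRel, Submodule.span_le]
  rintro _ ⟨c, s, x, rfl⟩
  rw [SetLike.mem_coe, LinearMap.mem_ker, map_sub, sub_eq_zero]
  change MulOpposite.op (φ x) • MulOpposite.op s • c = MulOpposite.op (φ (s • x)) • c
  rw [map_smul, smul_eq_mul, MulOpposite.op_mul, mul_smul]

/-- `C ⊗ N` is locally a finite sum of copies of `C`, embedded by `c ↦ c ⊗ b j`. Asking for all `u ⊇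
s` lets the finite sets of two tensors be united. -/
theorem exists_btensor_coordinates {J : Type u} (b : Module.Basis J S N) :
    ∃ π : J → BTensor R S C N →ₗ[R] C,
      (∀ j c x, π j (btmul R S c x) = MulOpposite.op (b.repr x j) • c) ∧
      ∀ t, ∃ s : Finset J, ∀ u, s ⊆ u → ∑ j ∈ u, mu R S (b j) (π j t) = t := by
  classical
  choose π hπ using fun j => exists_btensor_eval (R := R) (C := C) (b.coord j)
  refine ⟨π, hπ, fun t => ?_⟩
  induction t using btensor_induction with
  | h c x =>
    refine ⟨(b.repr x).support, fun u hu => ?_⟩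
    have hx : ∑ j ∈ u, b.repr x j • b j = x := by
      conv_rhs => rw [← b.linearCombination_repr x]
      rw [Finsupp.linearCombination_apply, Finsupp.sum_of_support_subset _ hu _ (by simp)]
    calc ∑ j ∈ u, mu R S (b j) (π j (btmul R S c x))
        = ∑ j ∈ u, mu R S (b.repr x j • b j) c := Finset.sum_congr rfl fun j _ => by
          rw [hπ, mu_smul]
          rfl
      _ = mu R S (∑ j ∈ u, b.repr x j • b j) c := by
          rw [← LinearMap.sum_apply]
          exact LinearMap.congr_fun (map_sum (⟨⟨mu R S, mu_zero⟩, mu_add R S⟩ :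
            N →+ (C →ₗ[R] BTensor R S C N)) _ _).symm c
      _ = btmul R S c x := by rw [hx]; rfl
  | hadd a d ha hd =>
    obtain ⟨s, hs⟩ := ha
    obtain ⟨s', hs'⟩ := hd
    refine ⟨s ∪ s', fun u hu => ?_⟩
    simp_rw [map_add, Finset.sum_add_distrib]
    rw [hs u (Finset.union_subset_left hu), hs' u (Finset.union_subset_right hu)]

/-- The `j`-th coordinate of `μ(x)` is the homothety by the `j`-th coordinate of `x`. Conversely the
coordinates of `f` are endomorphisms of `C`, hence homotheties `a j`, and finitely many suffice
because `C` is finitely generated. -/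
theorem mu_bijective_of_basis [Module.Finite R C]
    (hS : Function.Bijective (homothetyRight R S C)) {J : Type u} (b : Module.Basis J S N) :
    Function.Bijective (mu R S : N → (C →ₗ[R] BTensor R S C N)) := by
  obtain ⟨π, hπ, hsum⟩ := exists_btensor_coordinates (R := R) (C := C) b
  refine ⟨mu_injective_iff.2 fun x hx => b.ext_elem fun j => hS.1 (LinearMap.ext fun c => ?_),
    fun f => ?_⟩
  · have : π j (mu R S x c) = π j (mu R S (0 : N) c) := by rw [hx, mu_zero]
    exact (hπ j c x).symm.trans (this.trans (hπ j c 0))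
  · obtain ⟨s, hs⟩ := exists_finset_sum_eq hsum f
    choose a ha using fun j => hS.2 (π j ∘ₗ f)
    refine ⟨∑ j ∈ s, a j • b j, ?_⟩
    refine (map_sum (⟨⟨mu R S, mu_zero⟩, mu_add R S⟩ :
      N →+ (C →ₗ[R] BTensor R S C N)) _ _).trans (Eq.trans ?_ hs)
    refine Finset.sum_congr rfl fun j _ => LinearMap.ext fun c => ?_
    rw [← ha]
    exact mu_smul R S (a j) (b j) c

theorem auslanderClass_of_free (hC : IsSemidualizing R S C) (F : ModuleCat.{u} S)
    (hF : Module.Free S F) : auslanderClass R S C F := by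
  obtain ⟨P, hP⟩ := hC.finite_left
  have b := Module.Free.chooseBasis S F
  have : Module.Finite R C := by
    have := hP 0
    exact Module.Finite.of_surjective (P.π.f 0).hom ((ModuleCat.epi_iff_surjective _).1
      inferInstance)
  obtain ⟨π, -, hsum⟩ := exists_btensor_coordinates (R := R) (C := C) b
  refine ⟨fun i hi => ?_, fun i hi => ?_, mu_bijective_of_basis hC.homothety_right b⟩
  · obtain ⟨i, rfl⟩ := Nat.exists_eq_add_of_le' hi
    exact (tensorFunctor R S C).isZero_leftDerived_obj_projective_succ i F
  · obtain ⟨i, rfl⟩ := Nat.exists_eq_add_of_le' hi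
    exact subsingleton_ext_of_locally_sum P hP (Z := ModuleCat.of R C)
      (Y := (tensorFunctor R S C).obj F) hsum i (hC.ext_left (i + 1) hi)

theorem isResolving_auslanderClass (hC : IsSemidualizing R S C) :
    IsResolving (auslanderClass R S C) where
  free := auslanderClass_of_free hC
  ext f g hf hfg hg hL hN := auslanderClass.extension
    (N := ShortComplex.mk (ModuleCat.ofHom f) (ModuleCat.ofHom g)
      (ModuleCat.hom_ext hfg.linearMap_comp_eq_zero))
    (ModuleCat.shortComplex_shortExact _ hfg hf hg) hL hN
  ker f g hf hfg hg hM hN := auslanderClass.kernel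
    (N := ShortComplex.mk (ModuleCat.ofHom f) (ModuleCat.ofHom g)
      (ModuleCat.hom_ext hfg.linearMap_comp_eq_zero))
    (ModuleCat.shortComplex_shortExact _ hfg hf hg) hM hN

end Free

end AuslanderPd

end

/-- For a short exact sequence `0 → N₁ → N₂ → N₃ → 0`, if two of the modules have finite Auslander
projective dimension then so has the third: the class is closed under extensions, kernels of
epimorphisms and cokernels of monomorphisms. -/
theorem proposition4p2 (R S C : Type u) [Ring R] [Ring S] [AddCommGroup C] [Module R C]
    [Module Sᵐᵒᵖ C] [SMulCommClass R Sᵐᵒᵖ C] (hC : AuslanderPd.IsSemidualizing R S C) :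
    (∀ N : CategoryTheory.ShortComplex (ModuleCat.{u} S), N.ShortExact →
      AuslanderPd.finiteAuslanderPd R S C N.X₁ → AuslanderPd.finiteAuslanderPd R S C N.X₃ →
      AuslanderPd.finiteAuslanderPd R S C N.X₂) ∧
    (∀ N : CategoryTheory.ShortComplex (ModuleCat.{u} S), N.ShortExact →
      AuslanderPd.finiteAuslanderPd R S C N.X₂ → AuslanderPd.finiteAuslanderPd R S C N.X₃ →
      AuslanderPd.finiteAuslanderPd R S C N.X₁) ∧
    (∀ N : CategoryTheory.ShortComplex (ModuleCat.{u} S), N.ShortExact →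
      AuslanderPd.finiteAuslanderPd R S C N.X₁ → AuslanderPd.finiteAuslanderPd R S C N.X₂ →
      AuslanderPd.finiteAuslanderPd R S C N.X₃) := by
  have hP := AuslanderPd.isResolving_auslanderClass hC
  have hex := fun (N : ShortComplex (ModuleCat.{u} S)) (hN : N.ShortExact) =>
    (ShortComplex.ShortExact.moduleCat_exact_iff_function_exact N).1 hN.exact
  refine ⟨fun N hN h h' => ?_, fun N hN h h' => ?_, fun N hN h h' => ?_⟩
  · exact AuslanderPd.relProjDim_lt_top_ext N.f.hom N.g.hom hP hN.moduleCat_injective_f (hex N hN)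
      hN.moduleCat_surjective_g h h'
  · exact AuslanderPd.relProjDim_lt_top_ker N.f.hom N.g.hom hP hN.moduleCat_injective_f (hex N hN)
      hN.moduleCat_surjective_g h h'
  · exact AuslanderPd.relProjDim_lt_top_coker N.f.hom N.g.hom hP hN.moduleCat_injective_f
      (hex N hN) hN.moduleCat_surjective_g h h'
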